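/- **Setting.** Let $n\ge 2$, let $\overline M$ be a compact smooth $(n+1)$-manifold with boundary and interior $M$, and let $g=\rho^{-2}\bar g$ be a conformally compact metric on $M$: $\bar g$ is a Riemannian metric of class $\mathcal C^{3}$ on $\overline M$ up to the boundary and $\rho$ is a smooth defining function of the boundary ($\rho>0$ in $M$, $\rho=0$ and $d\rho\ne 0$ on $\partial M:=\partial\overline M$). An end of $M$ is represented by a connected component $N$ of $\partial M$. A *foliation of the end $N$ with compact leaves tending to $\partial M$* is a family $\mathcal F=\{\Sigma_\tau\}_{0<\tau<\tau_0}$ of pairwise disjoint compact connected embedded $\mathcal C^2$ hypersurfaces of $M$, whose union $\mathcal U$ is an open subset of $M$ such that $\mathcal U\cup N$ is a neighbourhood of $N$ in $\overline M$. Near each point of $\mathcal U$ there are continuous coordinates $(y,t)\in\mathbb R^n\times\mathbb R$ in which the leaf $\Sigma_\tau$ is the slice $\{t=\tau\}$, and $\Sigma_\tau\to N$ as $\tau\searrow 0$: for every neighbourhood $W$ of $N$ in $\overline M$ one has $\Sigma_\tau\subset W$ for all sufficiently small $\tau$. The mean curvature of a leaf is the sum of its principal curvatures with respect to the unit normal pointing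 outward, that is, to the side of smaller $\tau$ (with $\mathrm{II}=\tfrac12\mathcal L_\nu g$ for the outward normal $\nu$). The foliation is CMC if the mean curvature of each leaf $\Sigma_\tau$ is a constant $H_\tau$ (which may depend on $\tau$), and a CMC foliation is monotone decreasing if $\tau\mapsto H_\tau$ is strictly decreasing on $(0,\tau_0)$. **Proposition 3.1.** Let $\mathcal F$ be a monotone decreasing CMC foliation of the end $N$ of $(M,g)$ with compact leaves tending to $\partial M$. Then $\mathcal F$ is unique among all CMC foliations of that end with compact leaves tending to $\partial M$, in the following sense. If $\mathcal F'$ is any such CMC foliation, and $\mathcal U$, $\mathcal U'$ are the regions foliated by $\mathcal F$, $\mathcal F'$, then through every point of $\mathcal U\cap\mathcal U'$ the leaf of $\mathcal F'$ and the leaf of $\mathcal F$ are the same hypersurface. In particular, all leaves of $\mathcal F'$ with sufficiently small parameter are leaves of $\mathcal F$, and vice versa. -/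

import Mathlib

open scoped Manifold ContDiff Topology

noncomputable section

namespace CMCFol

/-- The model vector space `ℝ^m`. -/
abbrev E (m : ℕ) : Type := EuclideanSpace ℝ (Fin m)

/-! ### Hypersurface geometry in coordinates

`G : E m → Matrix (Fin m) (Fin m) ℝ` is the Gram matrix of a Riemannian metric in coordinates,
`F : E m → ℝ` a function with nonvanishing differential, whose level sets are hypersurfaces. -/

/-- The partial derivative `∂ᵢ F` at `x`. -/
def pderiv {m : ℕ} (F : E m → ℝ) (i : Fin m) (x : E m) : ℝ :=
  fderiv ℝ F x (EuclideanSpace.single i 1)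

/-- Christoffel symbols of the Levi-Civita connection,
`Γᵏᵢⱼ = ½ ∑ₗ Gᵏˡ (∂ᵢ Gⱼₗ + ∂ⱼ Gᵢₗ - ∂ₗ Gᵢⱼ)`. -/
def christoffel {m : ℕ} (G : E m → Matrix (Fin m) (Fin m) ℝ) (k i j : Fin m) (x : E m) : ℝ :=
  (1 / 2) * ∑ l, (G x)⁻¹ k l *
    (pderiv (fun y => G y j l) i x + pderiv (fun y => G y i l) j x - pderiv (fun y => G y i j) l x)

/-- The covariant Hessian `(∇²F)ᵢⱼ = ∂ᵢ∂ⱼF - ∑ₖ Γᵏᵢⱼ ∂ₖF`. -/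
def hess {m : ℕ} (G : E m → Matrix (Fin m) (Fin m) ℝ) (F : E m → ℝ) (i j : Fin m) (x : E m) : ℝ :=
  pderiv (pderiv F j) i x - ∑ k, christoffel G k i j x * pderiv F k x

/-- The length `|∇F|` of the gradient of `F` with respect to the metric `G`. -/
def gradNorm {m : ℕ} (G : E m → Matrix (Fin m) (Fin m) ℝ) (F : E m → ℝ) (x : E m) : ℝ :=
  Real.sqrt (∑ i, ∑ j, (G x)⁻¹ i j * pderiv F i x * pderiv F j x)

/-- Components of the unit normal `ν = -∇F / |∇F|` to the level set of `F`;
it points towards smaller values of `F`. -/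
def unitNormal {m : ℕ} (G : E m → Matrix (Fin m) (Fin m) ℝ) (F : E m → ℝ) (i : Fin m)
    (x : E m) : ℝ :=
  -(∑ j, (G x)⁻¹ i j * pderiv F j x) / gradNorm G F x

/-- The bilinear form `-∇²F / |∇F|`; on vectors tangent to the level set of `F` it is the second
fundamental form `II(X, Y) = ⟨∇_X ν, Y⟩ = ½ (L_ν G)(X, Y)` with respect to the normal `ν`. -/
def secondFundForm {m : ℕ} (G : E m → Matrix (Fin m) (Fin m) ℝ) (F : E m → ℝ) (i j : Fin m)
    (x : E m) : ℝ :=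
  -hess G F i j x / gradNorm G F x

/-- The mean curvature at `x` of the level set of `F` through `x` with respect to `ν`: the trace of
the second fundamental form over the tangent space of the level set (the sum of the principal
curvatures); `Gⁱʲ - νⁱ νʲ` is the inverse of the metric induced on that tangent space. -/
def coordMeanCurvature {m : ℕ} (G : E m → Matrix (Fin m) (Fin m) ℝ) (F : E m → ℝ)
    (x : E m) : ℝ :=
  ∑ i, ∑ j, ((G x)⁻¹ i j - unitNormal G F i x * unitNormal G F j x) * secondFundForm G F i j x

/-! ### Conformally compact metrics -/

section Manifold

variable (n : ℕ) (M : Type*) [TopologicalSpace M] [ChartedSpace (EuclideanHalfSpace (n + 1)) M]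
  [IsManifold (𝓡∂ (n + 1)) ∞ M]

/-- A conformally compact metric `g = ρ⁻² ḡ` on the interior of the `(n+1)`-manifold with
boundary `M`: `ḡ` is a `C³` Riemannian metric on `M` (up to the boundary) and `ρ` is a smooth
defining function of `∂M`. -/
structure ConformallyCompactMetric where
  /-- the compactified metric -/
  gbar : Bundle.ContMDiffRiemannianMetric (𝓡∂ (n + 1)) 3 (E (n + 1))
    (fun p : M => TangentSpace (𝓡∂ (n + 1)) p)
  /-- the boundary defining function -/
  rho : M → ℝ
  rho_smooth : ContMDiff (𝓡∂ (n + 1)) 𝓘(ℝ, ℝ) ∞ rho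
  rho_pos : ∀ p ∈ (𝓡∂ (n + 1)).interior M, 0 < rho p
  rho_zero : ∀ p ∈ (𝓡∂ (n + 1)).boundary M, rho p = 0
  rho_deriv : ∀ p ∈ (𝓡∂ (n + 1)).boundary M, mfderiv (𝓡∂ (n + 1)) 𝓘(ℝ, ℝ) rho p ≠ 0

variable {n M}

namespace ConformallyCompactMetric

/-- The metric `g = ρ⁻² ḡ` on tangent vectors at an interior point `p`. -/
def inner (g : ConformallyCompactMetric n M) (p : M) (v w : TangentSpace (𝓡∂ (n + 1)) p) : ℝ :=
  (g.rho p ^ 2)⁻¹ * g.gbar.inner p v w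

/-- The Gram matrix `g(∂ᵢ, ∂ⱼ)` of `g` in the coordinates given by the chart of `M` around `p`. -/
def gram (g : ConformallyCompactMetric n M) (p : M) (x : E (n + 1)) :
    Matrix (Fin (n + 1)) (Fin (n + 1)) ℝ :=
  Matrix.of fun i j =>
    g.inner ((extChartAt (𝓡∂ (n + 1)) p).symm x)
      (mfderivWithin 𝓘(ℝ, E (n + 1)) (𝓡∂ (n + 1)) (extChartAt (𝓡∂ (n + 1)) p).symm
        (Set.range (𝓡∂ (n + 1))) x (EuclideanSpace.single i (1 : ℝ) : E (n + 1)))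
      (mfderivWithin 𝓘(ℝ, E (n + 1)) (𝓡∂ (n + 1)) (extChartAt (𝓡∂ (n + 1)) p).symm
        (Set.range (𝓡∂ (n + 1))) x (EuclideanSpace.single j (1 : ℝ) : E (n + 1)))

/-- The mean curvature with respect to `g`, at the interior point `p`, of the level set through `p`
of a `C²` function `f` with `df(p) ≠ 0`, for the unit normal pointing towards smaller values of
`f`. -/
def meanCurvature (g : ConformallyCompactMetric n M) (f : M → ℝ) (p : M) : ℝ :=
  coordMeanCurvature (g.gram p) (f ∘ (extChartAt (𝓡∂ (n + 1)) p).symm) (extChartAt (𝓡∂ (n + 1)) p p)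

end ConformallyCompactMetric

/-- The ends of the interior of the compact manifold `M` correspond to the connected components
of `∂M`; the end is represented by that component. -/
def IsEnd (n : ℕ) {M : Type*} [TopologicalSpace M] [ChartedSpace (EuclideanHalfSpace (n + 1)) M]
    (N : Set M) : Prop :=
  ∃ x ∈ (𝓡∂ (n + 1)).boundary M, N = connectedComponentIn ((𝓡∂ (n + 1)).boundary M) x

/-- `f` is a local defining function at `p` for the level set through `p` of the function `τ`
(which may be only continuous): `f` is `C²` near `p`, `df(p) ≠ 0`, and near `p` the sets `{f < 0}`,
`{f = 0}`, `{f > 0}` are `{τ < τ p}`, `{τ = τ p}`, `{τ > τ p}`. -/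
def IsDefiningFunctionAt (n : ℕ) {M : Type*} [TopologicalSpace M]
    [ChartedSpace (EuclideanHalfSpace (n + 1)) M] (τ : M → ℝ) (p : M) (f : M → ℝ) : Prop :=
  ContMDiffAt (𝓡∂ (n + 1)) 𝓘(ℝ, ℝ) 2 f p ∧
  mfderiv (𝓡∂ (n + 1)) 𝓘(ℝ, ℝ) f p ≠ 0 ∧
  ∀ᶠ q in 𝓝 p, (f q < 0 ↔ τ q < τ p) ∧ (f q = 0 ↔ τ q = τ p) ∧ (0 < f q ↔ τ p < τ q)

/-- A codimension one foliation `{Σ_t}`, `0 < t < τ₀`, of a neighbourhood `U` of the end `N` (in the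
interior of `M`), with compact leaves which tend to `N` as `t → 0`. The leaf `Σ_t` is the
level set `{τ = t}` of the leaf parameter `τ : U → (0, τ₀)`. The foliation is locally a topological
product, and its leaves are compact connected `C²` hypersurfaces. -/
structure EndFoliation (n : ℕ) {M : Type*} [TopologicalSpace M]
    [ChartedSpace (EuclideanHalfSpace (n + 1)) M] (N : Set M) where
  /-- the foliated region -/
  U : Set M
  /-- the leaf parameter -/
  τ : M → ℝ
  /-- the upper end of the parameter interval -/
  τ₀ : ℝ
  τ₀_pos : 0 < τ₀
  isOpen_U : IsOpen U
  U_subset : U ⊆ (𝓡∂ (n + 1)).interior M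
  nhds_end : U ∪ N ∈ 𝓝ˢ N
  τ_mem : ∀ p ∈ U, τ p ∈ Set.Ioo 0 τ₀
  /-- foliation charts: near every point the leaves are the slices of a product -/
  chart : ∀ p ∈ U, ∃ e : OpenPartialHomeomorph M (E n × ℝ),
    p ∈ e.source ∧ e.source ⊆ U ∧ ∀ q ∈ e.source, (e q).2 = τ q
  /-- the leaves are `C²` hypersurfaces -/
  leaf_C2 : ∀ p ∈ U, ∃ f : M → ℝ, IsDefiningFunctionAt n τ p f
  leaf_connected : ∀ t ∈ Set.Ioo 0 τ₀, IsConnected {p | p ∈ U ∧ τ p = t}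
  leaf_compact : ∀ t ∈ Set.Ioo 0 τ₀, IsCompact {p | p ∈ U ∧ τ p = t}
  /-- the leaves tend to the end `N` as the parameter tends to `0` -/
  leaf_tendsto : ∀ W ∈ 𝓝ˢ N, ∃ δ > 0, ∀ p ∈ U, τ p < δ → p ∈ W

namespace EndFoliation

variable {N : Set M}

/-- The leaf with parameter `t`. -/
def leaf (F : EndFoliation n N) (t : ℝ) : Set M := {p | p ∈ F.U ∧ F.τ p = t}

/-- Every leaf `Σ_t` has constant mean curvature `H t` with respect to the outward unit normal,
that is, the one pointing to the side of smaller parameters, towards `N`. -/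
def HasMeanCurvature (F : EndFoliation n N) (g : ConformallyCompactMetric n M) (H : ℝ → ℝ) : Prop :=
  ∀ p ∈ F.U, ∀ f : M → ℝ, IsDefiningFunctionAt n F.τ p f → g.meanCurvature f p = H (F.τ p)

/-- All leaves have constant mean curvature (depending on the leaf). -/
def IsCMC (F : EndFoliation n N) (g : ConformallyCompactMetric n M) : Prop :=
  ∃ H : ℝ → ℝ, F.HasMeanCurvature g H

/-- A monotone decreasing CMC foliation: the mean curvature of the leaves is a strictly decreasing
function of the leaf parameter. -/
def IsMonotoneDecreasingCMC (F : EndFoliation n N) (g : ConformallyCompactMetric n M) : Prop :=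
  ∃ H : ℝ → ℝ, F.HasMeanCurvature g H ∧ StrictAntiOn H (Set.Ioo 0 F.τ₀)

end EndFoliation

end Manifold

end CMCFol

end

/-!
The argument is the tangency principle between the leaves of the two foliations, together with a
topological argument that fixes the direction of the normals.

Let `Σ'` be a leaf of `F'` contained in the region of `F`, and let `p` and `q` be points of the
compact set `Σ'` where the parameter `τ` of `F` is maximal and minimal. At `p` and `q` the leaf `Σ'`
touches the leaves of `F` through these points from one side. If the outward normals agree there,
the comparison of second derivatives at a point of contact gives `H (τ q) ≤ H' ≤ H (τ p)`, so
`τ p ≤ τ q` since `H` is strictly decreasing, and `τ` is constant on `Σ'`. The monotonicity of `H`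
is strict, so only the weak comparison is needed (`coordMeanCurvature_le`,
`ConformallyCompactMetric.meanCurvature_le`); it follows from second-order expansions along
parabolas through the point of contact.

The normals need not agree for an arbitrary leaf `Σ'` in the region of `F`: `Σ'` may fail to enclose
the same part of the manifold. They do agree if all leaves of `F'` between `Σ'` and `N` also lie in
the region of `F` (`EndFoliation.exists_leaf_eq_of_closedCollar_subset`). The leaves with parameter
below `a`, together with `N`, form an open collar of `N` with boundary `Σ_a`
(`EndFoliation.isOpen_collar`, `EndFoliation.isClosed_closedCollar`), the latter by the stability of
compact leaves. A connected set that avoids `Σ'` is therefore inside or outside the collar of `Σ'`.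
The leaves of `F` before `q` are inside because they tend to `N`, and those beyond `p` are outside
because the closed collar of `Σ'` is compact in the region of `F` and `N`.

Leaves of `F'` close to `N` satisfy this hypothesis, and a continuity argument in the leaf parameter
(`EndFoliation.closedCollar_subset`) extends it to all leaves of `F'` that meet the region of `F`.
-/

namespace CMCFol

open Set Filter

/-! ### Second-order comparison of functions along parabolas -/

theorem eventually_pos_of_second_deriv_pos {φ ψ : ℝ → ℝ} {a : ℝ}
    (hφ : ∀ᶠ t in 𝓝 0, HasDerivAt φ (ψ t) t) (hψ : HasDerivAt ψ a 0) (hφ0 : φ 0 = 0)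
    (hψ0 : ψ 0 = 0) (ha : 0 < a) : ∀ᶠ t in 𝓝[≠] 0, 0 < φ t := by
  -- the second derivative test for `φ t - (a / 4) t ^ 2` gives a strict inequality for `φ`
  set g : ℝ → ℝ := fun t => φ t - a / 4 * t ^ 2 with hg
  have h1 : ∀ᶠ t in 𝓝 0, HasDerivAt g (ψ t - a / 2 * t) t := by
    filter_upwards [hφ] with t ht
    have := ht.fun_sub ((hasDerivAt_pow 2 t).const_mul (a / 4))
    refine this.congr_deriv ?_
    push_cast
    ring
  have h2 : deriv g =ᶠ[𝓝 0] fun t => ψ t - a / 2 * t := h1.mono fun t ht => ht.deriv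
  have h3 : HasDerivAt (fun t => ψ t - a / 2 * t) (a - a / 2) 0 := by
    simpa using hψ.fun_sub ((hasDerivAt_id (0 : ℝ)).const_mul (a / 2))
  have hmin : IsLocalMin g 0 := by
    refine isLocalMin_of_deriv_deriv_pos ?_ ?_ h1.self_of_nhds.continuousAt
    · rw [h2.deriv_eq, h3.deriv]
      linarith
    · rw [h2.self_of_nhds]
      simp [hψ0]
  have hg0 : g 0 = 0 := by simp [hg, hφ0]
  filter_upwards [hmin.filter_mono nhdsWithin_le_nhds, self_mem_nhdsWithin] with t ht ht0
  rw [hg0] at ht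
  have : 0 < a / 4 * t ^ 2 := by
    have : t ≠ 0 := ht0
    positivity
  simp only [hg] at ht
  linarith

section Comparison

variable {V : Type*} [NormedAddCommGroup V] [NormedSpace ℝ V] {f f' : V → ℝ} {x : V}

theorem eventually_pos_of_fderiv_pos {v : V} (hf : DifferentiableAt ℝ f x) (hx : f x = 0)
    (hv : 0 < fderiv ℝ f x v) : ∀ᶠ t in 𝓝[>] (0 : ℝ), 0 < f (x + t • v) := by
  have h1 : HasDerivAt (fun t : ℝ => f (x + t • v)) (fderiv ℝ f x v) 0 := by
    have h2 : HasDerivAt (fun t : ℝ => x + t • v) v 0 := by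
      simpa using ((hasDerivAt_id (0 : ℝ)).smul_const v).const_add x
    have h3 : HasFDerivAt f (fderiv ℝ f x) (x + (0 : ℝ) • v) := by
      simpa using hf.hasFDerivAt
    exact h3.comp_hasDerivAt 0 h2
  have h4 := h1.tendsto_slope_zero_right
  filter_upwards [h4.eventually (lt_mem_nhds hv), self_mem_nhdsWithin] with t ht ht0
  have ht0 : 0 < t := ht0
  simp only [zero_add, zero_smul, add_zero, hx, sub_zero, smul_eq_mul] at ht
  exact (pos_iff_pos_of_mul_pos ht).1 (inv_pos.2 ht0)

theorem eventually_pos_of_hessian_pos {v u : V} (hf : ContDiffAt ℝ 2 f x) (hx : f x = 0)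
    (hv : fderiv ℝ f x v = 0)
    (hpos : 0 < fderiv ℝ (fderiv ℝ f) x v v + 2 * fderiv ℝ f x u) :
    ∀ᶠ t in 𝓝[≠] (0 : ℝ), 0 < f (x + t • v + t ^ 2 • u) := by
  set γ : ℝ → V := fun t => x + t • v + t ^ 2 • u with hγ
  have hγ' : ∀ t, HasDerivAt γ (v + (2 * t) • u) t := fun t => by
    have := (((hasDerivAt_id' t).smul_const v).const_add x).fun_add
      ((hasDerivAt_pow 2 t).smul_const u)
    refine this.congr_deriv ?_
    simp
  have hγ0 : γ 0 = x := by simp [hγ]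
  have hγc : Tendsto γ (𝓝 0) (𝓝 x) := by
    have := (hγ' 0).continuousAt.tendsto
    rwa [hγ0] at this
  have hd : ∀ᶠ y in 𝓝 x, DifferentiableAt ℝ f y :=
    (hf.eventually (by simp)).mono fun y hy => hy.differentiableAt (by simp)
  have hd2 : HasFDerivAt (fderiv ℝ f) (fderiv ℝ (fderiv ℝ f) x) (γ 0) := by
    rw [hγ0]
    exact ((hf.fderiv_right (m := 1) (by norm_num)).differentiableAt (by simp)).hasFDerivAt
  refine eventually_pos_of_second_deriv_pos (φ := fun t => f (γ t))
    (ψ := fun t => fderiv ℝ f (γ t) (v + (2 * t) • u)) ?_ ?_ (by simp [hγ0, hx])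
    (by simp [hγ0, hv]) hpos
  · filter_upwards [hγc.eventually hd] with t ht
    exact ht.hasFDerivAt.comp_hasDerivAt t (hγ' t)
  · have h1 : HasDerivAt (fun t => fderiv ℝ f (γ t)) (fderiv ℝ (fderiv ℝ f) x v) 0 := by
      have := hd2.comp_hasDerivAt 0 (hγ' 0)
      simpa [Function.comp_def] using this
    have h2 : HasDerivAt (fun t : ℝ => v + (2 * t) • u) ((2 : ℝ) • u) 0 := by
      have := (((hasDerivAt_id (0 : ℝ)).const_mul 2).smul_const u).const_add v
      simpa using this
    have := h1.clm_apply h2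
    simpa [hγ0] using this

/-- If `{f > 0}` lies in `{f' ≥ 0}` near a common zero, then the differentials there are positive
multiples of each other. -/
theorem fderiv_eq_smul_of_pos_imp_nonneg (hf : DifferentiableAt ℝ f x)
    (hf' : DifferentiableAt ℝ f' x) (hx : f x = 0) (hx' : f' x = 0)
    (h0 : fderiv ℝ f x ≠ 0) (h0' : fderiv ℝ f' x ≠ 0)
    (h : ∀ᶠ y in 𝓝 x, 0 < f y → 0 ≤ f' y) :
    ∃ c : ℝ, 0 < c ∧ fderiv ℝ f' x = c • fderiv ℝ f x := by
  have key : ∀ v, 0 < fderiv ℝ f x v → 0 ≤ fderiv ℝ f' x v := by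
    intro v hv
    by_contra! hneg
    have h1 := eventually_pos_of_fderiv_pos hf hx hv
    have h2 := eventually_pos_of_fderiv_pos (f := -f') (v := v) hf'.neg (by simp [hx'])
      (by simpa [fderiv_neg] using hneg)
    have h3 : Tendsto (fun t : ℝ => x + t • v) (𝓝[>] 0) (𝓝 x) := by
      have : Continuous fun t : ℝ => x + t • v := by fun_prop
      have := this.tendsto 0
      simp only [zero_smul, add_zero] at this
      exact this.mono_left nhdsWithin_le_nhds
    obtain ⟨t, ht1, ht2, ht3⟩ := (h1.and (h2.and (h3.eventually h))).exists
    have := ht3 ht1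
    simp only [Pi.neg_apply] at ht2
    linarith
  obtain ⟨w, hw⟩ : ∃ w, fderiv ℝ f x w = 1 := by
    obtain ⟨w, hw⟩ := DFunLike.ne_iff.1 h0
    exact ⟨(fderiv ℝ f x w)⁻¹ • w, by simpa using inv_mul_cancel₀ hw⟩
  have hker : ∀ v, fderiv ℝ f x v = 0 → 0 ≤ fderiv ℝ f' x v := by
    intro v hv
    have hlim : Tendsto (fun ε : ℝ => fderiv ℝ f' x (v + ε • w)) (𝓝[>] 0)
        (𝓝 (fderiv ℝ f' x v)) := by
      have : Continuous fun ε : ℝ => fderiv ℝ f' x (v + ε • w) := by fun_prop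
      have := this.tendsto 0
      simp only [zero_smul, add_zero] at this
      exact this.mono_left nhdsWithin_le_nhds
    refine ge_of_tendsto hlim ?_
    filter_upwards [self_mem_nhdsWithin] with ε hε
    exact key _ (by simpa [hv, hw] using hε)
  have heq : fderiv ℝ f' x = fderiv ℝ f' x w • fderiv ℝ f x := by
    ext v
    have hv : fderiv ℝ f x (v - fderiv ℝ f x v • w) = 0 := by simp [hw]
    have h1 := hker _ hv
    have h2 := hker (-(v - fderiv ℝ f x v • w)) (by rw [map_neg, hv, neg_zero])
    rw [map_neg] at h2
    have h3 : fderiv ℝ f' x (v - fderiv ℝ f x v • w) = 0 := by linarith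
    rw [map_sub, map_smul, sub_eq_zero] at h3
    simp [h3, mul_comm]
  refine ⟨fderiv ℝ f' x w, lt_of_le_of_ne (key w (by simp [hw])) fun h => h0' ?_, heq⟩
  rw [heq, ← h, zero_smul]

/-- If `{f > 0}` lies in `{f' ≥ 0}` near a common zero, then the normalised second derivatives are
ordered on the common tangent space of the two level sets. -/
theorem hessian_le_of_pos_imp_nonneg (hf : ContDiffAt ℝ 2 f x)
    (hf' : ContDiffAt ℝ 2 f' x) (hx : f x = 0) (hx' : f' x = 0)
    (h0 : fderiv ℝ f x ≠ 0) {c : ℝ} (hc : 0 < c) (heq : fderiv ℝ f' x = c • fderiv ℝ f x)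
    (h : ∀ᶠ y in 𝓝 x, 0 < f y → 0 ≤ f' y) {v : V} (hv : fderiv ℝ f x v = 0) :
    c * fderiv ℝ (fderiv ℝ f) x v v ≤ fderiv ℝ (fderiv ℝ f') x v v := by
  by_contra! hlt
  obtain ⟨w, hw⟩ : ∃ w, fderiv ℝ f x w = 1 := by
    obtain ⟨w, hw⟩ := DFunLike.ne_iff.1 h0
    exact ⟨(fderiv ℝ f x w)⁻¹ • w, by simpa using inv_mul_cancel₀ hw⟩
  set a := fderiv ℝ (fderiv ℝ f) x v v
  set b := fderiv ℝ (fderiv ℝ f') x v v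
  -- the parabola is bent so that `f` increases and `f'` decreases along it
  set k : ℝ := -(c * a + b) / (4 * c) with hk
  have hca : c * (a + 2 * k) = (c * a - b) / 2 := by
    rw [hk]
    field_simp
    ring
  have h1 := eventually_pos_of_hessian_pos (u := k • w) hf hx hv (by
    simp only [map_smul, hw, smul_eq_mul, mul_one]
    have : 0 < c * (a + 2 * k) := by rw [hca]; linarith
    exact (pos_iff_pos_of_mul_pos this).1 hc)
  have hneg : fderiv ℝ (-f') = -fderiv ℝ f' := by
    ext1 y
    simp [fderiv_neg]
  have h2 := eventually_pos_of_hessian_pos (f := -f') (v := v) (u := k • w) hf'.neg (by simp [hx'])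
    (by simp [hneg, heq, hv]) (by
    have : fderiv ℝ (fderiv ℝ (-f')) x = -fderiv ℝ (fderiv ℝ f') x := by
      rw [hneg, fderiv_neg]
    rw [this, hneg]
    simp only [neg_apply, Pi.neg_apply, map_smul, heq, smul_apply, hw, smul_eq_mul, mul_one]
    change 0 < -b + 2 * (k * -c)
    nlinarith)
  have h3 : Tendsto (fun t : ℝ => x + t • v + t ^ 2 • (k • w)) (𝓝[≠] 0) (𝓝 x) := by
    have : Continuous fun t : ℝ => x + t • v + t ^ 2 • (k • w) := by fun_prop
    have := this.tendsto 0
    simp only [zero_smul, add_zero, ne_eq, OfNat.ofNat_ne_zero, not_false_eq_true, zero_pow] at this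
    exact this.mono_left nhdsWithin_le_nhds
  obtain ⟨t, ht1, ht2, ht3⟩ := (h1.and (h2.and (h3.eventually h))).exists
  have := ht3 ht1
  simp only [Pi.neg_apply] at ht2
  linarith

end Comparison

/-! ### Comparison of mean curvatures in coordinates -/

section Coordinates

variable {m : ℕ} {G : E m → Matrix (Fin m) (Fin m) ℝ} {f f' : E m → ℝ} {x : E m}

theorem pderiv_pderiv_eq (hf : ContDiffAt ℝ 2 f x) (i j : Fin m) :
    pderiv (pderiv f j) i x = fderiv ℝ (fderiv ℝ f) x (EuclideanSpace.single i 1)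
      (EuclideanSpace.single j 1) := by
  have hd2 : DifferentiableAt ℝ (fderiv ℝ f) x :=
    (hf.fderiv_right (m := 1) (by norm_num)).differentiableAt (by simp)
  have : pderiv f j = fun y => fderiv ℝ f y (EuclideanSpace.single j 1) := rfl
  rw [this, pderiv, fderiv_clm_apply hd2 (differentiableAt_const _)]
  simp

open scoped MatrixOrder Matrix.Norms.L2Operator in
/-- The contraction of `A⁻¹ - ν νᵀ`, `ν = A⁻¹ ξ / |ξ|`, with a bilinear form that is nonnegative on
the kernel of `ξ` is nonnegative: `A⁻¹ - ν νᵀ` is a sum of squares of vectors annihilated by `ξ`. -/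
theorem sum_projection_mul_nonneg {A : Matrix (Fin m) (Fin m) ℝ} (hA : A.PosDef) {ξ : Fin m → ℝ}
    (hξ : ξ ≠ 0) {Q : Fin m → Fin m → ℝ}
    (hQ : ∀ b : Fin m → ℝ, ∑ i, b i * ξ i = 0 → 0 ≤ ∑ i, ∑ j, b i * b j * Q i j) :
    0 < ∑ i, ∑ j, A⁻¹ i j * ξ i * ξ j ∧
    0 ≤ ∑ i, ∑ j, (A⁻¹ i j - (∑ k, A⁻¹ i k * ξ k) * (∑ k, A⁻¹ j k * ξ k) /
      (∑ i, ∑ j, A⁻¹ i j * ξ i * ξ j)) * Q i j := by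
  have hS : 0 < ∑ i, ∑ j, A⁻¹ i j * ξ i * ξ j := by
    have := hA.inv.dotProduct_mulVec_pos hξ
    simp only [dotProduct, Matrix.mulVec, star_trivial, Finset.mul_sum] at this
    refine this.trans_eq (Finset.sum_congr rfl fun i _ => Finset.sum_congr rfl fun j _ => ?_)
    ring
  refine ⟨hS, ?_⟩
  set S := ∑ i, ∑ j, A⁻¹ i j * ξ i * ξ j with hSdef
  obtain ⟨L, hL⟩ : ∃ L : Matrix (Fin m) (Fin m) ℝ, A⁻¹ = L.conjTranspose * L :=
    CStarAlgebra.nonneg_iff_eq_star_mul_self.1 hA.inv.posSemidef.nonneg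
  have hL' : ∀ i j, A⁻¹ i j = ∑ k, L k i * L k j := fun i j => by
    rw [hL, Matrix.mul_apply]
    simp
  set a : Fin m → ℝ := fun k => ∑ i, L k i * ξ i with ha
  set u : Fin m → ℝ := fun i => ∑ k, A⁻¹ i k * ξ k with hu
  have hau : ∀ i, ∑ k, a k * L k i = u i := fun i => by
    simp only [ha, hu, hL', Finset.sum_mul]
    rw [Finset.sum_comm]
    exact Finset.sum_congr rfl fun j _ => Finset.sum_congr rfl fun k _ => by ring
  have huS : ∑ i, u i * ξ i = S := by
    simp only [hu, hSdef, Finset.sum_mul]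
    exact Finset.sum_congr rfl fun j _ => Finset.sum_congr rfl fun k _ => by ring
  have haS : ∑ k, a k * a k = S := by
    rw [← huS]
    simp only [← hau, Finset.sum_mul]
    rw [Finset.sum_comm]
    refine Finset.sum_congr rfl fun k _ => ?_
    conv_lhs => rw [ha]
    simp only [Finset.mul_sum]
    exact Finset.sum_congr rfl fun j _ => by simp only [ha]; ring
  set b : Fin m → Fin m → ℝ := fun k i => L k i - a k * u i / S with hb
  have hbξ : ∀ k, ∑ i, b k i * ξ i = 0 := fun k => by
    have : ∀ i, b k i * ξ i = L k i * ξ i - a k / S * (u i * ξ i) := fun i => by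
      simp only [hb]; ring
    simp only [this, Finset.sum_sub_distrib, ← Finset.mul_sum, huS]
    rw [div_mul_cancel₀ _ hS.ne']
    simp [ha]
  have hbb : ∀ i j, A⁻¹ i j - u i * u j / S = ∑ k, b k i * b k j := fun i j => by
    have : ∀ k, b k i * b k j = L k i * L k j - u j / S * (a k * L k i)
        - u i / S * (a k * L k j) + u i * u j / S ^ 2 * (a k * a k) := fun k => by
      simp only [hb]; ring
    simp only [this, Finset.sum_add_distrib, Finset.sum_sub_distrib, ← Finset.mul_sum, hau, haS,
      ← hL']
    field_simp
    ring
  have hfin : ∑ i, ∑ j, (A⁻¹ i j - u i * u j / S) * Q i j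
      = ∑ k, ∑ i, ∑ j, b k i * b k j * Q i j := by
    simp only [hbb, Finset.sum_mul]
    conv_rhs => rw [Finset.sum_comm]
    exact Finset.sum_congr rfl fun i _ => Finset.sum_comm
  rw [hfin]
  exact Finset.sum_nonneg fun k _ => hQ _ (hbξ k)

/-- Weak comparison principle: if two level sets touch at `x`, with `{f > 0}` inside `{f' ≥ 0}`,
then the mean curvature of the level set of `f'` does not exceed that of the level set of `f`. -/
theorem coordMeanCurvature_le (hG : (G x).PosDef) (hf : ContDiffAt ℝ 2 f x)
    (hf' : ContDiffAt ℝ 2 f' x) (hx : f x = 0) (hx' : f' x = 0)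
    (h0 : fderiv ℝ f x ≠ 0) (h0' : fderiv ℝ f' x ≠ 0)
    (h : ∀ᶠ y in 𝓝 x, 0 < f y → 0 ≤ f' y) :
    coordMeanCurvature G f' x ≤ coordMeanCurvature G f x := by
  obtain ⟨c, hc, heq⟩ := fderiv_eq_smul_of_pos_imp_nonneg (hf.differentiableAt (by simp))
    (hf'.differentiableAt (by simp)) hx hx' h0 h0' h
  have hp : ∀ i, pderiv f' i x = c * pderiv f i x := fun i => by simp [pderiv, heq]
  have hlin : ∀ b : Fin m → ℝ, fderiv ℝ f x (∑ i, b i • EuclideanSpace.single i 1) =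
      ∑ i, b i * pderiv f i x := fun b => by simp [map_sum, pderiv]
  have hξ : (fun i => pderiv f i x) ≠ 0 := by
    intro hz
    refine h0 ?_
    ext v
    have hv : v = ∑ i, v i • EuclideanSpace.single i (1 : ℝ) := by
      ext j
      simp [Finset.sum_apply, Pi.single_apply]
    rw [hv, hlin]
    simp [fun i => congrFun hz i]
  set Q : Fin m → Fin m → ℝ := fun i j => pderiv (pderiv f' j) i x - c * pderiv (pderiv f j) i x
    with hQdef
  have hQ : ∀ b : Fin m → ℝ, ∑ i, b i * pderiv f i x = 0 →
      0 ≤ ∑ i, ∑ j, b i * b j * Q i j := by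
    intro b hb
    have := hessian_le_of_pos_imp_nonneg hf hf' hx hx' h0 hc heq h
      (v := ∑ i, b i • EuclideanSpace.single i 1) (by rw [hlin, hb])
    have hexp : ∀ B : E m →L[ℝ] E m →L[ℝ] ℝ, B (∑ i, b i • EuclideanSpace.single i 1)
        (∑ i, b i • EuclideanSpace.single i 1) = ∑ i, ∑ j, b i * b j *
          B (EuclideanSpace.single i 1) (EuclideanSpace.single j 1) := fun B => by
      simp only [map_sum, sum_apply, map_smul, smul_apply, smul_eq_mul]
      rw [Finset.sum_comm]
      refine Finset.sum_congr rfl fun i _ => ?_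
      rw [Finset.mul_sum]
      exact Finset.sum_congr rfl fun j _ => by ring
    rw [hexp, hexp] at this
    simp only [hQdef, pderiv_pderiv_eq hf, pderiv_pderiv_eq hf', mul_sub, Finset.sum_sub_distrib]
    rw [Finset.mul_sum] at this
    simp only [Finset.mul_sum, mul_left_comm c] at this ⊢
    linarith
  obtain ⟨hS, hnonneg⟩ := sum_projection_mul_nonneg hG hξ hQ
  set S := ∑ i, ∑ j, (G x)⁻¹ i j * pderiv f i x * pderiv f j x with hSdef
  have hs : gradNorm G f x = √S := rfl
  have hs0 : 0 < √S := Real.sqrt_pos.2 hS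
  have hs' : gradNorm G f' x = c * √S := by
    have : ∑ i, ∑ j, (G x)⁻¹ i j * pderiv f' i x * pderiv f' j x = c ^ 2 * S := by
      simp only [hp, hSdef, Finset.mul_sum]
      exact Finset.sum_congr rfl fun j _ => Finset.sum_congr rfl fun k _ => by ring
    rw [gradNorm, this, Real.sqrt_mul (by positivity), Real.sqrt_sq hc.le]
  have hν : ∀ i, unitNormal G f' i x = unitNormal G f i x := fun i => by
    have : ∑ j, (G x)⁻¹ i j * pderiv f' j x = c * ∑ j, (G x)⁻¹ i j * pderiv f j x := by
      simp only [hp, Finset.mul_sum]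
      exact Finset.sum_congr rfl fun k _ => by ring
    rw [unitNormal, unitNormal, hs', hs, this, ← mul_neg, mul_div_mul_left _ _ hc.ne']
  have hνν : ∀ i j, unitNormal G f i x * unitNormal G f j x =
      (∑ k, (G x)⁻¹ i k * pderiv f k x) * (∑ k, (G x)⁻¹ j k * pderiv f k x) / S := fun i j => by
    rw [unitNormal, unitNormal, hs, div_mul_div_comm, neg_mul_neg, Real.mul_self_sqrt hS.le]
  have hhess : ∀ i j, hess G f' i j x - c * hess G f i j x = Q i j := fun i j => by
    have : ∑ k, christoffel G k i j x * pderiv f' k x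
        = c * ∑ k, christoffel G k i j x * pderiv f k x := by
      simp only [hp, Finset.mul_sum]
      exact Finset.sum_congr rfl fun k _ => by ring
    simp only [hess, hQdef, this]
    ring
  have hII : ∀ i j, secondFundForm G f i j x - secondFundForm G f' i j x
      = (c * √S)⁻¹ * Q i j := fun i j => by
    rw [secondFundForm, secondFundForm, hs, hs', ← hhess]
    field_simp
    ring
  have hdiff : coordMeanCurvature G f x - coordMeanCurvature G f' x = (c * √S)⁻¹ *
      ∑ i, ∑ j, ((G x)⁻¹ i j - (∑ k, (G x)⁻¹ i k * pderiv f k x) *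
        (∑ k, (G x)⁻¹ j k * pderiv f k x) / S) * Q i j := by
    simp only [coordMeanCurvature, hν, ← Finset.sum_sub_distrib, ← mul_sub, hII, hνν,
      Finset.mul_sum]
    exact Finset.sum_congr rfl fun j _ => Finset.sum_congr rfl fun k _ => by ring
  have : 0 ≤ coordMeanCurvature G f x - coordMeanCurvature G f' x := by
    rw [hdiff]
    positivity
  linarith

end Coordinates

/-! ### Comparison of mean curvatures on the manifold -/

theorem posDef_of_bilinear_pullback {m : ℕ} {V : Type*} [AddCommGroup V] [Module ℝ V]
    [TopologicalSpace V] [IsTopologicalAddGroup V] [ContinuousSMul ℝ V] (B : V →L[ℝ] V →L[ℝ] ℝ)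
    (hsymm : ∀ v w, B v w = B w v) (hpos : ∀ v, v ≠ 0 → 0 < B v v) (D : E m →L[ℝ] V)
    (hD : Function.Injective D) {r : ℝ} (hr : 0 < r) :
    (Matrix.of fun i j => r * B (D (EuclideanSpace.single i 1))
      (D (EuclideanSpace.single j 1)) : Matrix (Fin m) (Fin m) ℝ).PosDef := by
  refine Matrix.PosDef.of_dotProduct_mulVec_pos ?_ fun v hv => ?_
  · ext i j
    simp only [Matrix.conjTranspose_apply, star_trivial, Matrix.of_apply]
    rw [hsymm]
  · set w : E m := ∑ i, v i • EuclideanSpace.single i (1 : ℝ) with hw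
    have hw0 : w ≠ 0 := by
      intro h
      refine hv (funext fun j => ?_)
      have := congrArg (fun z : E m => z j) h
      simpa [hw, Pi.single_apply] using this
    have hDw : D w ≠ 0 := fun h => hw0 (hD (h.trans (map_zero D).symm))
    refine (mul_pos hr (hpos (D w) hDw)).trans_eq ?_
    simp only [hw, map_sum, sum_apply, map_smul, smul_apply, smul_eq_mul, dotProduct,
      Matrix.mulVec, star_trivial, Finset.mul_sum, Matrix.of_apply]
    refine Finset.sum_congr rfl fun i _ => Finset.sum_congr rfl fun j _ => ?_
    rw [hsymm]
    ring

section Manifold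

variable {n : ℕ} {M : Type*} [TopologicalSpace M] [ChartedSpace (EuclideanHalfSpace (n + 1)) M]
  [IsManifold (𝓡∂ (n + 1)) ∞ M]

theorem ConformallyCompactMetric.gram_posDef (g : ConformallyCompactMetric n M) {p : M}
    (hp : p ∈ (𝓡∂ (n + 1)).interior M) :
    (g.gram p (extChartAt (𝓡∂ (n + 1)) p p)).PosDef := by
  set x := extChartAt (𝓡∂ (n + 1)) p p with hx
  set q := (extChartAt (𝓡∂ (n + 1)) p).symm x with hq
  have hqp : q = p := extChartAt_to_inv p
  have hρ : 0 < (g.rho q ^ 2)⁻¹ := by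
    have := g.rho_pos p hp
    rw [hqp]
    positivity
  set D := mfderivWithin 𝓘(ℝ, E (n + 1)) (𝓡∂ (n + 1)) (extChartAt (𝓡∂ (n + 1)) p).symm
    (range (𝓡∂ (n + 1))) x with hD
  have : IsManifold (𝓡∂ (n + 1)) 1 M := IsManifold.of_le (n := ∞) (by simp)
  have hinj : Function.Injective D :=
    (isInvertible_mfderivWithin_extChartAt_symm (mem_extChartAt_target p)).injective
  exact posDef_of_bilinear_pullback (V := TangentSpace (𝓡∂ (n + 1)) q) (g.gbar.inner q)
    (g.gbar.symm q) (g.gbar.pos q) D hinj hρ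

/-- The weak comparison principle for level sets touching at an interior point. -/
theorem ConformallyCompactMetric.meanCurvature_le (g : ConformallyCompactMetric n M) {p : M}
    (hp : p ∈ (𝓡∂ (n + 1)).interior M) {τ τ' f f' : M → ℝ} (hf : IsDefiningFunctionAt n τ p f)
    (hf' : IsDefiningFunctionAt n τ' p f') (h : ∀ᶠ q in 𝓝 p, τ p < τ q → τ' p ≤ τ' q) :
    g.meanCurvature f' p ≤ g.meanCurvature f p := by
  set φ := extChartAt (𝓡∂ (n + 1)) p with hφ
  have hrange : range (𝓡∂ (n + 1)) ∈ 𝓝 (φ p) := range_mem_nhds_isInteriorPoint hp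
  have hsmooth : ∀ {u : M → ℝ}, ContMDiffAt (𝓡∂ (n + 1)) 𝓘(ℝ, ℝ) 2 u p →
      ContDiffAt ℝ 2 (u ∘ φ.symm) (φ p) := fun {u} hu => by
    have := (contMDiffAt_iff_source.1 hu).contMDiffAt hrange
    exact this.contDiffAt
  have hderiv : ∀ {u : M → ℝ}, ContMDiffAt (𝓡∂ (n + 1)) 𝓘(ℝ, ℝ) 2 u p →
      mfderiv (𝓡∂ (n + 1)) 𝓘(ℝ, ℝ) u p ≠ 0 → fderiv ℝ (u ∘ φ.symm) (φ p) ≠ 0 := by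
    intro u hu hne h0
    refine hne ?_
    rw [(hu.mdifferentiableAt (by simp)).mfderiv, fderivWithin_of_mem_nhds hrange]
    exact h0
  have hφp : φ.symm (φ p) = p := extChartAt_to_inv p
  have hlim : Tendsto φ.symm (𝓝 (φ p)) (𝓝 p) := by
    have := (continuousAt_extChartAt_symm (I := 𝓡∂ (n + 1)) p).tendsto
    rwa [extChartAt_to_inv] at this
  have hzero : ∀ {σ u : M → ℝ}, IsDefiningFunctionAt n σ p u → (u ∘ φ.symm) (φ p) = 0 :=
    fun {σ u} hu => by
      rw [Function.comp_apply, hφp]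
      exact (hu.2.2.self_of_nhds.2.1).2 rfl
  refine coordMeanCurvature_le (g.gram_posDef hp) (hsmooth hf.1) (hsmooth hf'.1) (hzero hf)
    (hzero hf') (hderiv hf.1 hf.2.1) (hderiv hf'.1 hf'.2.1) ?_
  change ∀ᶠ y in 𝓝 (φ p), 0 < f (φ.symm y) → 0 ≤ f' (φ.symm y)
  refine hlim.eventually (p := fun q => 0 < f q → 0 ≤ f' q) ?_
  filter_upwards [h, hf.2.2, hf'.2.2] with q hq h1 h2 hpos
  have := hq (h1.2.2.1 hpos)
  by_contra! hneg
  exact absurd (h2.1.1 hneg) (not_lt.2 this)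

end Manifold

/-! ### Topology of a manifold with boundary near an end -/

theorem mem_of_le_nhdsSet_of_le_nhds {X : Type*} [TopologicalSpace X] [T2Space X] {C : Set X}
    (hC : IsCompact C) {l : Filter X} [l.NeBot] {x : X} (h : l ≤ 𝓝ˢ C) (hx : l ≤ 𝓝 x) : x ∈ C := by
  by_contra hxC
  have hd := (SeparatedNhds.of_isCompact_isCompact hC isCompact_singleton
    (disjoint_singleton_right.2 hxC)).disjoint_nhdsSet
  rw [nhdsSet_singleton] at hd
  exact NeBot.ne ‹_› (le_bot_iff.1 (hd h hx))

section Ends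

variable {n : ℕ} {M : Type*} [TopologicalSpace M] [ChartedSpace (EuclideanHalfSpace (n + 1)) M]
  {N : Set M}

theorem IsEnd.subset_boundary (hN : IsEnd n N) : N ⊆ (𝓡∂ (n + 1)).boundary M := by
  obtain ⟨x, -, rfl⟩ := hN
  exact connectedComponentIn_subset _ _

theorem IsEnd.isConnected (hN : IsEnd n N) : IsConnected N := by
  obtain ⟨x, hx, rfl⟩ := hN
  exact isConnected_connectedComponentIn_iff.2 hx

theorem IsEnd.notMem_of_mem_interior (hN : IsEnd n N) {p : M}
    (hp : p ∈ (𝓡∂ (n + 1)).interior M) : p ∉ N := fun h =>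
  disjoint_left.1 (𝓡∂ (n + 1)).disjoint_interior_boundary hp (hN.subset_boundary h)

variable [IsManifold (𝓡∂ (n + 1)) ∞ M]

/-- Every point of a manifold with boundary, boundary points included, has arbitrarily small
neighbourhoods whose trace on the interior is connected: half balls in a chart. -/
theorem exists_nhds_isConnected_inter_interior (x : M) {W : Set M} (hW : W ∈ 𝓝 x) :
    ∃ V ∈ 𝓝 x, V ⊆ W ∧ IsConnected (V ∩ (𝓡∂ (n + 1)).interior M) := by
  set φ := extChartAt (𝓡∂ (n + 1)) x with hφ
  have h1 : φ.target ∩ φ.symm ⁻¹' W ∈ 𝓝[range (𝓡∂ (n + 1))] (φ x) :=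
    inter_mem (extChartAt_target_mem_nhdsWithin x)
      (mem_nhdsWithin_of_mem_nhds ((continuousAt_extChartAt_symm x).preimage_mem_nhds
        (by rwa [extChartAt_to_inv])))
  obtain ⟨r, hr, hball⟩ := Metric.mem_nhdsWithin_iff.1 h1
  set V : Set M := φ.source ∩ φ ⁻¹' Metric.ball (φ x) r with hV
  have hVint : V ∩ (𝓡∂ (n + 1)).interior M =
      φ.symm '' (Metric.ball (φ x) r ∩ interior (range (𝓡∂ (n + 1)))) := by
    have hchart : ∀ q ∈ φ.source, q ∈ (𝓡∂ (n + 1)).interior M ↔ φ q ∈ interior φ.target := by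
      intro q hq
      rw [hφ, extChartAt_source] at hq
      exact (𝓡∂ (n + 1)).isInteriorPoint_iff_of_mem_atlas (n := ∞) (by simp)
        (chart_mem_atlas _ x) hq
    have hint : Metric.ball (φ x) r ∩ interior (range (𝓡∂ (n + 1))) ⊆ interior φ.target := by
      refine interior_maximal (fun y hy => ?_) (Metric.isOpen_ball.inter isOpen_interior)
      exact (hball ⟨hy.1, interior_subset hy.2⟩).1
    ext q
    constructor
    · rintro ⟨⟨hq, hqr⟩, hqi⟩
      refine ⟨φ q, ⟨hqr, ?_⟩, φ.left_inv hq⟩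
      exact interior_mono (extChartAt_target_subset_range x) ((hchart q hq).1 hqi)
    · rintro ⟨y, hy, rfl⟩
      have hyt : y ∈ φ.target := interior_subset (hint hy)
      refine ⟨⟨φ.map_target hyt, ?_⟩, (hchart _ (φ.map_target hyt)).2 ?_⟩
      · rw [mem_preimage, φ.right_inv hyt]
        exact hy.1
      · rw [φ.right_inv hyt]
        exact hint hy
  refine ⟨V, ?_, ?_, ?_⟩
  · exact inter_mem (extChartAt_source_mem_nhds x)
      ((continuousAt_extChartAt x).preimage_mem_nhds (Metric.ball_mem_nhds _ hr))
  · rintro q ⟨hq, hqr⟩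
    have := (hball ⟨hqr, extChartAt_target_subset_range x (φ.map_source hq)⟩).2
    rwa [mem_preimage, φ.left_inv hq] at this
  · rw [hVint]
    refine IsConnected.image ⟨?_, ?_⟩ _ ?_
    · have hx : φ x ∈ closure (interior (range (𝓡∂ (n + 1)))) :=
        (𝓡∂ (n + 1)).range_subset_closure_interior (mem_range_self _)
      exact mem_closure_iff.1 hx _ Metric.isOpen_ball (Metric.mem_ball_self hr)
    · exact ((convex_ball _ _).inter (𝓡∂ (n + 1)).convex_range.interior).isPreconnected
    · refine (continuousOn_extChartAt_symm x).mono fun y hy => ?_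
      exact (hball ⟨hy.1, interior_subset hy.2⟩).1

theorem IsEnd.isClosed (hN : IsEnd n N) : IsClosed N := by
  have hb : IsClosed ((𝓡∂ (n + 1)).boundary M) := (𝓡∂ (n + 1)).isClosed_boundary (n := ∞) (by simp)
  have hsub := closure_minimal hN.subset_boundary hb
  have hpre := hN.isConnected.isPreconnected.closure
  obtain ⟨x, hx, rfl⟩ := hN
  exact isClosed_of_closure_subset
    (hpre.subset_connectedComponentIn (subset_closure (mem_connectedComponentIn hx)) hsub)

end Ends

/-! ### Topology of a foliation of an end -/

namespace EndFoliation

variable {n : ℕ} {M : Type*} [TopologicalSpace M] [ChartedSpace (EuclideanHalfSpace (n + 1)) M]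
  {N : Set M}

/-- The part of the end cut off by the leaf `Σ_a`: the leaves with parameter `< a`, together with
the boundary component `N`. -/
def collar (F : EndFoliation n N) (a : ℝ) : Set M := {p | p ∈ F.U ∧ F.τ p < a} ∪ N

/-- The collar together with its bounding leaf: the leaves with parameter `≤ a`, together with the
boundary component `N`. -/
def closedCollar (F : EndFoliation n N) (a : ℝ) : Set M := {p | p ∈ F.U ∧ F.τ p ≤ a} ∪ N

variable (F : EndFoliation n N)

theorem collar_mono {a b : ℝ} (h : a ≤ b) : F.collar a ⊆ F.collar b :=
  union_subset_union_left _ fun _ hp => ⟨hp.1, hp.2.trans_le h⟩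

theorem closedCollar_mono {a b : ℝ} (h : a ≤ b) : F.closedCollar a ⊆ F.closedCollar b :=
  union_subset_union_left _ fun _ hp => ⟨hp.1, hp.2.trans h⟩

theorem closedCollar_eq_union (a : ℝ) : F.closedCollar a = F.collar a ∪ F.leaf a := by
  ext p
  simp only [closedCollar, collar, leaf, mem_union, mem_ofPred_eq, le_iff_lt_or_eq]
  tauto

theorem mem_collar_iff (hN : IsEnd n N) {p : M} (hp : p ∈ F.U) {a : ℝ} :
    p ∈ F.collar a ↔ F.τ p < a := by
  simp [collar, hp, hN.notMem_of_mem_interior (F.U_subset hp)]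

theorem mem_closedCollar_iff (hN : IsEnd n N) {p : M} (hp : p ∈ F.U) {a : ℝ} :
    p ∈ F.closedCollar a ↔ F.τ p ≤ a := by
  simp [closedCollar, hp, hN.notMem_of_mem_interior (F.U_subset hp)]

theorem leaf_nonempty {t : ℝ} (ht : t ∈ Ioo 0 F.τ₀) : (F.leaf t).Nonempty :=
  (F.leaf_connected t ht).nonempty

/-- The leaf parameter is continuous and open at each point of the foliated region. -/
theorem map_τ_nhds {p : M} (hp : p ∈ F.U) : map F.τ (𝓝 p) = 𝓝 (F.τ p) := by
  obtain ⟨e, hpe, -, he⟩ := F.chart p hp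
  have h1 : F.τ =ᶠ[𝓝 p] Prod.snd ∘ e := by
    filter_upwards [e.open_source.mem_nhds hpe] with q hq using (he q hq).symm
  rw [map_congr h1, ← map_map, e.map_nhds_eq hpe, map_snd_nhds, he p hpe]

theorem continuousOn_τ : ContinuousOn F.τ F.U := fun _ hp =>
  ContinuousAt.continuousWithinAt (F.map_τ_nhds hp).le

theorem isOpen_preimage_τ {J : Set ℝ} (hJ : IsOpen J) : IsOpen {p | p ∈ F.U ∧ F.τ p ∈ J} :=
  F.continuousOn_τ.isOpen_inter_preimage F.isOpen_U hJ

theorem image_τ_mem_nhds {p : M} (hp : p ∈ F.U) {V : Set M} (hV : V ∈ 𝓝 p) :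
    F.τ '' (V ∩ F.U) ∈ 𝓝 (F.τ p) := by
  rw [← F.map_τ_nhds hp]
  exact image_mem_map (inter_mem hV (F.isOpen_U.mem_nhds hp))

theorem exists_mem_τ_lt {p : M} (hp : p ∈ F.U) {V : Set M} (hV : V ∈ 𝓝 p) :
    ∃ q ∈ V, q ∈ F.U ∧ F.τ q < F.τ p := by
  obtain ⟨_, ⟨q, hq, rfl⟩, hs⟩ := (𝓝[<] (F.τ p)).nonempty_of_mem
    (inter_mem (mem_nhdsWithin_of_mem_nhds (F.image_τ_mem_nhds hp hV)) self_mem_nhdsWithin)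
  exact ⟨q, hq.1, hq.2, hs⟩

theorem exists_mem_lt_τ {p : M} (hp : p ∈ F.U) {V : Set M} (hV : V ∈ 𝓝 p) :
    ∃ q ∈ V, q ∈ F.U ∧ F.τ p < F.τ q := by
  obtain ⟨_, ⟨q, hq, rfl⟩, hs⟩ := (𝓝[>] (F.τ p)).nonempty_of_mem
    (inter_mem (mem_nhdsWithin_of_mem_nhds (F.image_τ_mem_nhds hp hV)) self_mem_nhdsWithin)
  exact ⟨q, hq.1, hq.2, hs⟩

/-- A set of leaves given by an open interval of parameters is connected. -/
theorem isPreconnected_preimage_τ {J : Set ℝ} (hJ : IsPreconnected J)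
    (hJ' : J ⊆ Ioo 0 F.τ₀) (hJo : IsOpen J) : IsPreconnected {p | p ∈ F.U ∧ F.τ p ∈ J} := by
  rintro u v hu hv hsub ⟨x, hx, hxu⟩ ⟨y, hy, hyv⟩
  have hopen : ∀ w : Set M, IsOpen w → IsOpen (F.τ '' ({p | p ∈ F.U ∧ F.τ p ∈ J} ∩ w)) := by
    intro w hw
    refine isOpen_iff_mem_nhds.2 ?_
    rintro _ ⟨p, hp, rfl⟩
    rw [← F.map_τ_nhds hp.1.1]
    exact image_mem_map (((F.isOpen_preimage_τ hJo).inter hw).mem_nhds hp)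
  obtain ⟨s, hsJ, ⟨p, ⟨hp, hpu⟩, hps⟩, q, ⟨hq, hqv⟩, hqs⟩ := hJ _ _ (hopen u hu) (hopen v hv)
    (fun s hs => by
      obtain ⟨p, hp, rfl⟩ := F.leaf_nonempty (hJ' hs)
      rcases hsub (show p ∈ {p | p ∈ F.U ∧ F.τ p ∈ J} from ⟨hp, hs⟩) with h | h
      · exact Or.inl ⟨p, ⟨⟨hp, hs⟩, h⟩, rfl⟩
      · exact Or.inr ⟨p, ⟨⟨hp, hs⟩, h⟩, rfl⟩)
    ⟨F.τ x, hx.2, mem_image_of_mem _ ⟨hx, hxu⟩⟩ ⟨F.τ y, hy.2, mem_image_of_mem _ ⟨hy, hyv⟩⟩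
  have hleaf : F.leaf s ⊆ {p | p ∈ F.U ∧ F.τ p ∈ J} := fun r hr => ⟨hr.1, hr.2.symm ▸ hsJ⟩
  obtain ⟨r, hr, hruv⟩ := (F.leaf_connected s (hJ' hsJ)).isPreconnected u v hu hv
    (Subset.trans hleaf hsub) ⟨p, ⟨hp.1, hps⟩, hpu⟩ ⟨q, ⟨hq.1, hqs⟩, hqv⟩
  exact ⟨r, hleaf hr, hruv⟩

theorem exists_closedCollar_subset {W : Set M} (hW : W ∈ 𝓝ˢ N) :
    ∃ δ > 0, ∀ t < δ, F.closedCollar t ⊆ W := by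
  obtain ⟨δ, hδ, h⟩ := F.leaf_tendsto W hW
  refine ⟨δ, hδ, fun t ht => ?_⟩
  rintro x (hx | hx)
  · exact h x hx.1 (hx.2.trans_lt ht)
  · exact subset_of_mem_nhdsSet hW hx

theorem leaf_subset_closure_collar (a : ℝ) :
    F.leaf a ⊆ closure (F.collar a) := by
  intro r hr
  refine mem_closure_iff_nhds.2 fun V hV => ?_
  obtain ⟨y, hy, hyU, hyr⟩ := F.exists_mem_τ_lt hr.1 hV
  exact ⟨y, hy, Or.inl ⟨hyU, hr.2 ▸ hyr⟩⟩

section Compact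

variable [T2Space M]

/-- The collar of a leaf is a neighbourhood of `N`. Near a point of `N` the interior of `M` is
connected and avoids the leaf, so it lies on one side of it; this side is the same along the
connected set `N`, and it contains the leaves that tend to `N`. -/
theorem isOpen_collar [IsManifold (𝓡∂ (n + 1)) ∞ M] {F : EndFoliation n N} (hN : IsEnd n N)
    {a : ℝ} (ha : a ∈ Ioo 0 F.τ₀) : IsOpen (F.collar a) := by
  set A := {p | p ∈ F.U ∧ F.τ p ∈ Iio a} with hA
  set B := {p | p ∈ F.U ∧ F.τ p ∈ Ioi a} with hB
  have hAo : IsOpen A := F.isOpen_preimage_τ isOpen_Iio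
  have hBo : IsOpen B := F.isOpen_preimage_τ isOpen_Ioi
  have hAB : Disjoint A B :=
    disjoint_left.2 fun p hp hp' => lt_asymm (show F.τ p < a from hp.2) hp'.2
  set PA := {x : M | ∀ᶠ q in 𝓝 x, q ∈ (𝓡∂ (n + 1)).interior M → q ∈ A} with hPA
  set PB := {x : M | ∀ᶠ q in 𝓝 x, q ∈ (𝓡∂ (n + 1)).interior M → q ∈ B} with hPB
  have hPAB : Disjoint PA PB := by
    refine disjoint_left.2 fun x hx hx' => ?_
    obtain ⟨V, -, hVW, hVc⟩ := exists_nhds_isConnected_inter_interior (n := n) x (hx.and hx')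
    obtain ⟨q, hqV, hqi⟩ := hVc.nonempty
    exact disjoint_left.1 hAB ((hVW hqV).1 hqi) ((hVW hqV).2 hqi)
  have hcov : N ⊆ PA ∪ PB := by
    intro x hx
    have hxL : x ∈ (F.leaf a)ᶜ := fun h => hN.notMem_of_mem_interior (F.U_subset h.1) hx
    have hLc : IsCompact (F.leaf a) := F.leaf_compact a ha
    obtain ⟨V, hV, hVW, hVc⟩ := exists_nhds_isConnected_inter_interior (n := n) x
      (inter_mem (mem_nhdsSet_iff_forall.1 F.nhds_end x hx) (hLc.isClosed.isOpen_compl.mem_nhds hxL))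
    have hVAB : V ∩ (𝓡∂ (n + 1)).interior M ⊆ A ∪ B := by
      rintro q ⟨hqV, hqi⟩
      have hqU : q ∈ F.U := (hVW hqV).1.resolve_right (hN.notMem_of_mem_interior hqi)
      rcases lt_trichotomy (F.τ q) a with h | h | h
      · exact Or.inl ⟨hqU, h⟩
      · exact absurd ⟨hqU, h⟩ (hVW hqV).2
      · exact Or.inr ⟨hqU, h⟩
    rcases hVc.isPreconnected.subset_or_subset hAo hBo hAB hVAB with h | h
    · exact Or.inl (mem_of_superset hV fun q hq hqi => h ⟨hq, hqi⟩)
    · exact Or.inr (mem_of_superset hV fun q hq hqi => h ⟨hq, hqi⟩)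
  have hNA : N ⊆ PA := by
    refine (hN.isConnected.isPreconnected.subset_or_subset isOpen_setOfPred_eventually_nhds
      isOpen_setOfPred_eventually_nhds hPAB hcov).resolve_right fun hNB => ?_
    obtain ⟨δ, hδ, hW⟩ := F.leaf_tendsto _ (mem_nhdsSet_iff_forall.2 hNB)
    have hs : min δ a / 2 < min δ a := half_lt_self (lt_min hδ ha.1)
    have hs' : min δ a / 2 ∈ Ioo 0 F.τ₀ :=
      ⟨half_pos (lt_min hδ ha.1), hs.trans ((min_le_right _ _).trans_lt ha.2)⟩
    obtain ⟨p, hpU, hp⟩ := F.leaf_nonempty hs'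
    have hpB : p ∈ B := hW p hpU (by rw [hp]; exact hs.trans_le (min_le_left _ _)) (F.U_subset hpU)
    have : a < F.τ p := hpB.2
    rw [hp] at this
    exact absurd (this.trans (hs.trans_le (min_le_right _ _))) (lt_irrefl _)
  refine isOpen_iff_mem_nhds.2 ?_
  rintro x (hx | hx)
  · exact mem_of_superset (hAo.mem_nhds hx) subset_union_left
  · filter_upwards [hNA hx, mem_nhdsSet_iff_forall.1 F.nhds_end x hx] with q hq hqUN
    rcases hqUN with h | h
    · exact Or.inl (hq (F.U_subset h))
    · exact Or.inr h

/-- A compact subset of `U ∪ N` lies in the collar of some leaf. -/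
theorem exists_subset_collar [IsManifold (𝓡∂ (n + 1)) ∞ M] {F : EndFoliation n N} (hN : IsEnd n N)
    {K : Set M} (hK : IsCompact K) (hKU : K ⊆ F.U ∪ N) :
    ∃ b ∈ Ioo 0 F.τ₀, K ⊆ F.collar b := by
  have hmid : ∀ s < F.τ₀, ∃ b ∈ Ioo 0 F.τ₀, s < b := fun s hs => by
    obtain ⟨b, hb, hb'⟩ := exists_between (max_lt hs F.τ₀_pos)
    exact ⟨b, ⟨(le_max_right _ _).trans_lt hb, hb'⟩, (le_max_left _ _).trans_lt hb⟩
  have hne : Nonempty (Ioo 0 F.τ₀) := by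
    obtain ⟨b, hb, -⟩ := hmid 0 F.τ₀_pos
    exact ⟨⟨b, hb⟩⟩
  obtain ⟨⟨b, hb⟩, hKb⟩ := hK.elim_directed_cover (fun b : Ioo 0 F.τ₀ => F.collar b)
    (fun b => isOpen_collar hN b.2) (fun p hp => by
      rcases hKU hp with h | h
      · obtain ⟨b, hb, hpb⟩ := hmid _ (F.τ_mem p h).2
        exact mem_iUnion.2 ⟨⟨b, hb⟩, Or.inl ⟨h, hpb⟩⟩
      · exact mem_iUnion.2 ⟨Classical.arbitrary _, Or.inr h⟩)
    (Monotone.directed_le fun a b hab => F.collar_mono hab)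
  exact ⟨b, hb, hKb⟩

variable [CompactSpace M]

/-- Stability of compact leaves: the leaves near `Σ_t` are contained in any given neighbourhood of
`Σ_t`. They meet it because `τ` is open, and they cannot leave it because they are connected and,
`τ` being bounded away from `t` there, do not meet its boundary. -/
theorem eventually_leaf_subset {t : ℝ} (ht : t ∈ Ioo 0 F.τ₀) {V : Set M} (hV : IsOpen V)
    (hsub : F.leaf t ⊆ V) : ∀ᶠ s in 𝓝 t, F.leaf s ⊆ V := by
  obtain ⟨K, hK, htK, hKV⟩ := exists_compact_between (F.leaf_compact t ht)
    (hV.inter F.isOpen_U) (fun p hp => ⟨hsub hp, hp.1⟩)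
  set S := K \ interior K with hS
  have hSc : IsCompact S := hK.diff isOpen_interior
  have hτS : IsClosed (F.τ '' S) :=
    (hSc.image_of_continuousOn (F.continuousOn_τ.mono fun p hp => (hKV hp.1).2)).isClosed
  have htS : t ∉ F.τ '' S := by
    rintro ⟨p, hp, hpt⟩
    exact hp.2 (htK ⟨(hKV hp.1).2, hpt⟩)
  obtain ⟨p₀, hp₀⟩ := F.leaf_nonempty ht
  have himg : F.τ '' (interior K) ∈ 𝓝 t := by
    rw [← hp₀.2, ← F.map_τ_nhds hp₀.1]
    exact image_mem_map (isOpen_interior.mem_nhds (htK hp₀))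
  filter_upwards [hτS.isOpen_compl.mem_nhds htS, himg, isOpen_Ioo.mem_nhds ht] with s hsS hsK hs
  obtain ⟨q, hqK, hqs⟩ := hsK
  have hpre : IsPreconnected (F.leaf s) := (F.leaf_connected s hs).isPreconnected
  have hcov : F.leaf s ⊆ interior K ∪ Kᶜ := fun r hr => by
    by_contra hcon
    rw [mem_union, not_or, mem_compl_iff, not_not] at hcon
    exact hsS ⟨r, ⟨hcon.2, hcon.1⟩, hr.2⟩
  rcases hpre.subset_or_subset isOpen_interior hK.isClosed.isOpen_compl
    (disjoint_compl_right.mono_left interior_subset) hcov with h | h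
  · exact fun r hr => (hKV (interior_subset (h hr))).1
  · exact absurd (interior_subset hqK) (h ⟨(hKV (interior_subset hqK)).2, hqs⟩)

/-- If the closed collar of a leaf lies in `W ∪ N` for an open set `W`, then so do the closed collars
of the leaves with slightly larger parameter. -/
theorem exists_gt_closedCollar_subset {W : Set M} (hW : IsOpen W) {t : ℝ} (ht : t ∈ Ioo 0 F.τ₀)
    (hN : IsEnd n N) (hsub : F.closedCollar t ⊆ W ∪ N) :
    ∃ t' ∈ Ioo t F.τ₀, F.closedCollar t' ⊆ W ∪ N := by
  have hLW : F.leaf t ⊆ W := fun r hr =>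
    (hsub (Or.inl ⟨hr.1, hr.2.le⟩)).resolve_right (hN.notMem_of_mem_interior (F.U_subset hr.1))
  obtain ⟨l, u, htlu, hlu⟩ := mem_nhds_iff_exists_Ioo_subset.1 (F.eventually_leaf_subset ht hW hLW)
  obtain ⟨t', htt', ht'⟩ := exists_between (lt_min htlu.2 ht.2)
  refine ⟨t', ⟨htt', ht'.trans_le (min_le_right _ _)⟩, ?_⟩
  rintro x (hx | hx)
  · rcases le_or_gt (F.τ x) t with h | h
    · exact hsub (Or.inl ⟨hx.1, h⟩)
    · have hxI : F.τ x ∈ Ioo l u :=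
        ⟨htlu.1.trans h, hx.2.trans_lt (ht'.trans_le (min_le_left _ _))⟩
      exact Or.inl (hlu hxI ⟨hx.1, rfl⟩)
  · exact Or.inr hx

variable {F} [IsManifold (𝓡∂ (n + 1)) ∞ M]

theorem isClosed_closedCollar (hN : IsEnd n N) {a : ℝ} (ha : a < F.τ₀) :
    IsClosed (F.closedCollar a) := by
  rw [isClosed_iff_ultrafilter]
  intro x u hux hu
  rcases Ultrafilter.union_mem_iff.1 hu with hS | hNu
  swap
  · exact Or.inr (isClosed_iff_ultrafilter.1 hN.isClosed x u hux hNu)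
  have hIcc : Icc 0 a ∈ u.map F.τ :=
    Ultrafilter.mem_map.2 (mem_of_superset hS fun p hp => ⟨(F.τ_mem p hp.1).1.le, hp.2⟩)
  obtain ⟨t, ht, hut⟩ := isCompact_Icc.ultrafilter_le_nhds (u.map F.τ) (le_principal_iff.2 hIcc)
  have hut' : Tendsto F.τ u (𝓝 t) := hut
  rcases ht.1.eq_or_lt with h0 | h0
  · refine Or.inr (mem_of_le_nhdsSet_of_le_nhds hN.isClosed.isCompact (l := u) ?_ hux)
    intro W hW
    obtain ⟨δ, hδ, hW'⟩ := F.leaf_tendsto W hW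
    filter_upwards [hS, hut'.eventually (gt_mem_nhds (h0 ▸ hδ))] with p hp hpδ
    exact hW' p hp.1 hpδ
  · have ht' : t ∈ Ioo 0 F.τ₀ := ⟨h0, ht.2.trans_lt ha⟩
    have hx : x ∈ F.leaf t := by
      refine mem_of_le_nhdsSet_of_le_nhds (F.leaf_compact t ht') (l := u) ?_ hux
      intro W hW
      obtain ⟨V, hV, hVt, hVW⟩ := mem_nhdsSet_iff_exists.1 hW
      filter_upwards [hS, hut'.eventually (F.eventually_leaf_subset ht' hV hVt)] with p hp hpV
      exact hVW (hpV ⟨hp.1, rfl⟩)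
    exact Or.inl ⟨hx.1, hx.2.trans_le ht.2⟩

theorem isCompact_closedCollar (hN : IsEnd n N) {a : ℝ} (ha : a < F.τ₀) :
    IsCompact (F.closedCollar a) :=
  (isClosed_closedCollar hN ha).isCompact

/-- A leaf separates `M`: a connected set avoiding it lies in its collar or outside it. -/
theorem subset_collar_or_subset_compl (hN : IsEnd n N) {a : ℝ} (ha : a ∈ Ioo 0 F.τ₀) {S : Set M}
    (hS : IsPreconnected S) (hSa : Disjoint S (F.leaf a)) :
    S ⊆ F.collar a ∨ S ⊆ (F.closedCollar a)ᶜ := by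
  refine hS.subset_or_subset (isOpen_collar hN ha) (isClosed_closedCollar hN ha.2).isOpen_compl ?_ ?_
  · rw [closedCollar_eq_union]
    exact disjoint_compl_right.mono_left subset_union_left
  · intro p hp
    rw [closedCollar_eq_union]
    by_cases h : p ∈ F.collar a
    · exact Or.inl h
    · exact Or.inr fun h' => h'.elim h (disjoint_left.1 hSa hp)

end Compact

end EndFoliation

/-! ### Uniqueness of monotone foliations -/

namespace EndFoliation

variable {n : ℕ} {M : Type*} [TopologicalSpace M] [T2Space M] [CompactSpace M]
  [ChartedSpace (EuclideanHalfSpace (n + 1)) M] [IsManifold (𝓡∂ (n + 1)) ∞ M] {N : Set M}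
  {g : ConformallyCompactMetric n M} {F F' : EndFoliation n N} {H H' : ℝ → ℝ}

/-- A leaf of `F'` whose closed collar lies in the region foliated by `F` is a leaf of `F`: at the
extrema of `τ` on it the weak comparison principle orders the mean curvatures against the
monotonicity of `H`. The collars decide which way the two normals point at the extrema. -/
theorem exists_leaf_eq_of_closedCollar_subset (hN : IsEnd n N) (hF : F.HasMeanCurvature g H)
    (hH : StrictAntiOn H (Ioo 0 F.τ₀)) (hF' : F'.HasMeanCurvature g H') {t : ℝ}
    (ht : t ∈ Ioo 0 F'.τ₀) (hsub : F'.closedCollar t ⊆ F.U ∪ N) :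
    ∃ a ∈ Ioo 0 F.τ₀, F'.leaf t = F.leaf a ∧ F'.collar t = F.collar a := by
  have hLU : F'.leaf t ⊆ F.U := fun r hr =>
    (hsub (Or.inl ⟨hr.1, hr.2.le⟩)).resolve_right (hN.notMem_of_mem_interior (F'.U_subset hr.1))
  have hcol : F'.collar t ⊆ F'.closedCollar t := by
    rw [closedCollar_eq_union]
    exact subset_union_left
  obtain ⟨p, hp, hmax⟩ := (F'.leaf_compact t ht).exists_isMaxOn (F'.leaf_nonempty ht)
    (F.continuousOn_τ.mono hLU)
  obtain ⟨q, hq, hmin⟩ := (F'.leaf_compact t ht).exists_isMinOn (F'.leaf_nonempty ht)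
    (F.continuousOn_τ.mono hLU)
  have hpU : p ∈ F.U := hLU hp
  have hqU : q ∈ F.U := hLU hq
  have hτp := F.τ_mem p hpU
  have hτq := F.τ_mem q hqU
  -- the leaves beyond the maximum lie outside the collar of the leaf of `F'`: they cannot all lie
  -- inside, because the closed collar is compact and so is contained in a collar of `F`
  have hout : ∀ r ∈ F.U, F.τ p < F.τ r → r ∉ F'.closedCollar t := by
    have hpre : IsPreconnected {r | r ∈ F.U ∧ F.τ r ∈ Ioo (F.τ p) F.τ₀} :=
      F.isPreconnected_preimage_τ isPreconnected_Ioo (Ioo_subset_Ioo_left hτp.1.le) isOpen_Ioo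
    have hdisj : Disjoint {r | r ∈ F.U ∧ F.τ r ∈ Ioo (F.τ p) F.τ₀} (F'.leaf t) :=
      disjoint_left.2 fun r hr hr' => absurd (hmax hr') (not_le.2 hr.2.1)
    rcases subset_collar_or_subset_compl hN ht hpre hdisj with h | h
    · obtain ⟨b, hb, hKb⟩ := exists_subset_collar hN (isCompact_closedCollar hN ht.2) hsub
      obtain ⟨s, hs, hs'⟩ := exists_between (max_lt hτp.2 hb.2)
      have hps : F.τ p < s := (le_max_left _ _).trans_lt hs
      obtain ⟨r, hrU, hr⟩ := F.leaf_nonempty ⟨hτp.1.trans hps, hs'⟩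
      have hrb := (F.mem_collar_iff hN hrU).1 (hKb (hcol (h ⟨hrU, by rw [hr]; exact ⟨hps, hs'⟩⟩)))
      rw [hr] at hrb
      exact absurd hrb (not_lt.2 ((le_max_right _ _).trans hs.le))
    · exact fun r hr hpr => h ⟨hr, hpr, (F.τ_mem r hr).2⟩
  -- the leaves before the minimum lie inside, because the collar is a neighbourhood of `N`
  have hin : ∀ r ∈ F.U, F.τ r < F.τ q → r ∈ F'.collar t := by
    have hpre : IsPreconnected {r | r ∈ F.U ∧ F.τ r ∈ Ioo 0 (F.τ q)} :=
      F.isPreconnected_preimage_τ isPreconnected_Ioo (Ioo_subset_Ioo_right hτq.2.le) isOpen_Ioo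
    have hdisj : Disjoint {r | r ∈ F.U ∧ F.τ r ∈ Ioo 0 (F.τ q)} (F'.leaf t) :=
      disjoint_left.2 fun r hr hr' => absurd (hmin hr') (not_le.2 hr.2.2)
    rcases subset_collar_or_subset_compl hN ht hpre hdisj with h | h
    · exact fun r hr hrq => h ⟨hr, (F.τ_mem r hr).1, hrq⟩
    · obtain ⟨δ, hδ, hW⟩ := F.leaf_tendsto _
        ((isOpen_collar hN ht).mem_nhdsSet.2 (subset_union_right : N ⊆ F'.collar t))
      obtain ⟨s, hs, hs'⟩ := exists_between (lt_min hδ hτq.1)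
      obtain ⟨r, hrU, hr⟩ := F.leaf_nonempty ⟨hs, (hs'.trans_le (min_le_right _ _)).trans hτq.2⟩
      exact absurd (hcol (hW r hrU (hr.trans_lt (hs'.trans_le (min_le_left _ _)))))
        (h ⟨hrU, by rw [hr]; exact ⟨hs, hs'.trans_le (min_le_right _ _)⟩⟩)
  have hHp : H' t ≤ H (F.τ p) := by
    obtain ⟨f, hf⟩ := F.leaf_C2 p hpU
    obtain ⟨f', hf'⟩ := F'.leaf_C2 p hp.1
    rw [← hF p hpU f hf, ← hp.2, ← hF' p hp.1 f' hf']
    refine g.meanCurvature_le (F.U_subset hpU) hf hf' ?_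
    filter_upwards [F.isOpen_U.mem_nhds hpU, F'.isOpen_U.mem_nhds hp.1] with r hr hr' hpr
    have := hout r hr hpr
    rw [F'.mem_closedCollar_iff hN hr', not_le] at this
    exact hp.2.trans_le this.le
  have hHq : H (F.τ q) ≤ H' t := by
    obtain ⟨f, hf⟩ := F.leaf_C2 q hqU
    obtain ⟨f', hf'⟩ := F'.leaf_C2 q hq.1
    rw [← hF q hqU f hf, ← hq.2, ← hF' q hq.1 f' hf']
    refine g.meanCurvature_le (F.U_subset hqU) hf' hf ?_
    filter_upwards [F.isOpen_U.mem_nhds hqU, F'.isOpen_U.mem_nhds hq.1] with r hr hr' hqr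
    by_contra! hrq
    have := (F'.mem_collar_iff hN hr').1 (hin r hr hrq)
    rw [hq.2] at hqr
    exact lt_asymm hqr this
  have hpq : F.τ p = F.τ q := by
    refine le_antisymm (not_lt.1 fun h => ?_) (hmax hq)
    exact absurd (hHq.trans hHp) (not_le.2 (hH hτq hτp h))
  have hleaf : F'.leaf t = F.leaf (F.τ p) := by
    refine Subset.antisymm (fun r hr => ⟨hLU hr, le_antisymm (hmax hr) (hpq ▸ hmin hr)⟩) ?_
    intro r hr
    by_contra hrt
    by_cases hrc : r ∈ F'.collar t
    · obtain ⟨y, hy, hyU, hry⟩ := F.exists_mem_lt_τ hr.1 ((isOpen_collar hN ht).mem_nhds hrc)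
      exact hout y hyU (hr.2 ▸ hry) (hcol hy)
    · have hrc' : r ∈ (F'.closedCollar t)ᶜ := by
        rw [closedCollar_eq_union]
        exact fun h => h.elim hrc hrt
      obtain ⟨y, hy, hyU, hyr⟩ := F.exists_mem_τ_lt hr.1
        ((isClosed_closedCollar hN ht.2).isOpen_compl.mem_nhds hrc')
      exact hy (hcol (hin y hyU (by rw [← hpq, ← hr.2]; exact hyr)))
  refine ⟨F.τ p, hτp, hleaf, Subset.antisymm (fun r hr => ?_) ?_⟩
  · rcases hsub (hcol hr) with hrU | hrN
    · refine Or.inl ⟨hrU, lt_of_le_of_ne (not_lt.1 fun h => hout r hrU h (hcol hr)) fun h => ?_⟩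
      have hrt : r ∈ F'.leaf t := hleaf ▸ ⟨hrU, h⟩
      exact absurd hrt.2 ((F'.mem_collar_iff hN hrt.1).1 hr).ne
    · exact Or.inr hrN
  · rintro r (hr | hr)
    · exact hin r hr.1 (hpq ▸ hr.2)
    · exact Or.inr hr

/-- The leaf of `F'` through a common point of the two foliated regions has its closed collar in
the region of `F`. Otherwise let `t₁` be the supremum of the parameters with this property. The
collars of the leaves of `F'` before `t₁` are collars of leaves of `F` not enclosing the common
point, so the leaf with parameter `t₁` still lies in the region of `F`, and the property holds
slightly beyond `t₁`. -/
theorem closedCollar_subset (hN : IsEnd n N) (hF : F.HasMeanCurvature g H)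
    (hH : StrictAntiOn H (Ioo 0 F.τ₀)) (hF' : F'.HasMeanCurvature g H') {p : M} (hp : p ∈ F.U)
    (hp' : p ∈ F'.U) : F'.closedCollar (F'.τ p) ⊆ F.U ∪ N := by
  by_contra hcon
  set T := {t | t ∈ Ioo 0 F'.τ₀ ∧ F'.closedCollar t ⊆ F.U ∪ N} with hT
  have hτp' := F'.τ_mem p hp'
  have hTle : ∀ t ∈ T, t ≤ F'.τ p := fun t ht =>
    not_lt.1 fun h => hcon ((F'.closedCollar_mono h.le).trans ht.2)
  obtain ⟨t₀, ht₀⟩ : T.Nonempty := by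
    obtain ⟨δ, hδ, h⟩ := F'.exists_closedCollar_subset F.nhds_end
    obtain ⟨t, ht, ht'⟩ := exists_between (lt_min hδ F'.τ₀_pos)
    exact ⟨t, ⟨ht, ht'.trans_le (min_le_right _ _)⟩, h t (ht'.trans_le (min_le_left _ _))⟩
  have hTb : BddAbove T := ⟨_, hTle⟩
  set t₁ := sSup T with ht₁
  have ht₁mem : t₁ ∈ Ioo 0 F'.τ₀ :=
    ⟨ht₀.1.1.trans_le (le_csSup hTb ht₀), (csSup_le ⟨t₀, ht₀⟩ hTle).trans_lt hτp'.2⟩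
  set A := {a | a ∈ Ioo 0 F.τ₀ ∧ ∃ t ∈ T, F'.collar t = F.collar a} with hA
  have hTA : ∀ t ∈ T, ∃ a ∈ A, F'.collar t = F.collar a := fun t ht => by
    obtain ⟨a, ha, -, hta⟩ := exists_leaf_eq_of_closedCollar_subset hN hF hH hF' ht.1 ht.2
    exact ⟨a, ⟨ha, t, ht, hta⟩, hta⟩
  have hAle : ∀ a ∈ A, a ≤ F.τ p := by
    rintro a ⟨-, t, ht, hta⟩
    refine not_lt.1 fun h => ?_
    have hpa := (F.mem_collar_iff hN hp).2 h
    rw [← hta, F'.mem_collar_iff hN hp'] at hpa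
    exact absurd (hTle t ht) (not_le.2 hpa)
  obtain ⟨a₀, ha₀, -⟩ := hTA t₀ ht₀
  have hA1 : sSup A < F.τ₀ := (csSup_le ⟨a₀, ha₀⟩ hAle).trans_lt (F.τ_mem p hp).2
  have hcol : F'.collar t₁ ⊆ F.closedCollar (sSup A) := by
    rintro x (hx | hx)
    · obtain ⟨t, ht, hxt⟩ := exists_lt_of_lt_csSup ⟨t₀, ht₀⟩ hx.2
      obtain ⟨a, ha, hta⟩ := hTA t ht
      have hxa : x ∈ F.collar a := hta ▸ Or.inl ⟨hx.1, hxt⟩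
      refine F.closedCollar_mono (le_csSup ⟨_, hAle⟩ ha) ?_
      rw [closedCollar_eq_union]
      exact Or.inl hxa
    · exact Or.inr hx
  have hclosed : F'.closedCollar t₁ ⊆ F.U ∪ N := by
    have h1 : F'.closedCollar t₁ ⊆ F.closedCollar (sSup A) := by
      rw [closedCollar_eq_union]
      exact union_subset hcol ((F'.leaf_subset_closure_collar t₁).trans
        (closure_minimal hcol (isClosed_closedCollar hN hA1)))
    exact h1.trans (union_subset_union_left _ fun _ hx => hx.1)
  obtain ⟨t', ht', hsub⟩ := F'.exists_gt_closedCollar_subset F.isOpen_U ht₁mem hN hclosed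
  have : t' ∈ T := ⟨⟨ht₁mem.1.trans ht'.1, ht'.2⟩, hsub⟩
  exact absurd (le_csSup hTb this) (not_le.2 ht'.1)

end EndFoliation

end CMCFol

theorem proposition3p1 {n : ℕ} (hn : 2 ≤ n) {M : Type*} [TopologicalSpace M] [T2Space M]
    [CompactSpace M] [ChartedSpace (EuclideanHalfSpace (n + 1)) M]
    [IsManifold (𝓡∂ (n + 1)) ∞ M] (g : CMCFol.ConformallyCompactMetric n M)
    {N : Set M} (hN : CMCFol.IsEnd n N) (F F' : CMCFol.EndFoliation n N)
    (hF : F.IsMonotoneDecreasingCMC g) (hF' : F'.IsCMC g) :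
    (∀ p ∈ F.U ∩ F'.U, F'.leaf (F'.τ p) = F.leaf (F.τ p)) ∧
    ∃ δ > 0, (∀ t ∈ Set.Ioo 0 δ, ∃ s ∈ Set.Ioo 0 F.τ₀, F'.leaf t = F.leaf s) ∧
      (∀ s ∈ Set.Ioo 0 δ, ∃ t ∈ Set.Ioo 0 F'.τ₀, F.leaf s = F'.leaf t) := by
  obtain ⟨H, hH, hanti⟩ := hF
  obtain ⟨H', hH'⟩ := hF'
  have hmain : ∀ p ∈ F.U ∩ F'.U, F'.leaf (F'.τ p) = F.leaf (F.τ p) := by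
    rintro p ⟨hp, hp'⟩
    obtain ⟨a, -, ha, -⟩ := CMCFol.EndFoliation.exists_leaf_eq_of_closedCollar_subset hN hH hanti hH'
      (F'.τ_mem p hp') (CMCFol.EndFoliation.closedCollar_subset hN hH hanti hH' hp hp')
    have hpa : p ∈ F.leaf a := ha ▸ ⟨hp', rfl⟩
    rw [ha, hpa.2]
  refine ⟨hmain, ?_⟩
  -- leaves with small parameter lie in both foliated regions, where the first part applies
  obtain ⟨δ, hδ, h⟩ := F'.leaf_tendsto _ F.nhds_end
  obtain ⟨δ', hδ', h'⟩ := F.leaf_tendsto _ F'.nhds_end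
  refine ⟨min (min δ F'.τ₀) (min δ' F.τ₀), lt_min (lt_min hδ F'.τ₀_pos) (lt_min hδ' F.τ₀_pos),
    fun t ht => ?_, fun s hs => ?_⟩
  · obtain ⟨⟨htδ, htτ⟩, -⟩ := (lt_min_iff.1 ht.2).imp lt_min_iff.1 id
    obtain ⟨p, hp', rfl⟩ := F'.leaf_nonempty ⟨ht.1, htτ⟩
    have hp : p ∈ F.U :=
      (h p hp' htδ).resolve_right (hN.notMem_of_mem_interior (F'.U_subset hp'))
    exact ⟨F.τ p, F.τ_mem p hp, hmain p ⟨hp, hp'⟩⟩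
  · obtain ⟨-, hsδ, hsτ⟩ := (lt_min_iff.1 hs.2).imp id lt_min_iff.1
    obtain ⟨p, hp, rfl⟩ := F.leaf_nonempty ⟨hs.1, hsτ⟩
    have hp' : p ∈ F'.U :=
      (h' p hp hsδ).resolve_right (hN.notMem_of_mem_interior (F.U_subset hp))
    exact ⟨F'.τ p, F'.τ_mem p hp', (hmain p ⟨hp, hp'⟩).symm⟩
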